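/- There is an absolute constant $C>0$ with the following property. Let $\mathbb{H}$ be a real separable Hilbert space with norm $\|\cdot\|_{\mathbb{H}}$, let $(\Omega,\mathcal{A},\mathbb{P})$ be a probability space, let $T:\Omega\to\Omega$ be a bijective bimeasurable transformation preserving $\mathbb{P}$, and let $\mathcal{F}_0\subseteq\mathcal{A}$ be a $\sigma$-field with $\mathcal{F}_0\subseteq T^{-1}(\mathcal{F}_0)$; put $\mathcal{F}_i=T^{-i}(\mathcal{F}_0)$ for $i\in\mathbb{Z}$. Let $X_0$ be an $\mathbb{H}$-valued random variable on $\Omega$, not necessarily $\mathcal{F}_0$-measurable, with $\mathbb{E}(X_0)=0$ and $\|\|X_0\|_{\mathbb{H}}\|_\infty<\infty$, where $\|\|Y\|_{\mathbb{H}}\|_\infty$ is the smallest $u$ with $\mathbb{P}(\|Y\|_{\mathbb{H}}>u)=0$. Put $X_i=X_0\circ T^i$ for $i\in\mathbb{Z}$ and $S_n=\sum_{j=1}^n X_j$. Then for every integer $n\ge 1$ and every real $x>0$, $$\mathbb{P}\Big(\max_{1\le i\le n}\|S_i\|_{\mathbb{H}}\ge x\Big)\le 2\sqrt{e}\,\exp\left(-\frac{x^2}{4n\big(\|\|X_0\|_{\mathbb{H}}\|_\infty+C\Delta\big)^2}\right),$$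 where $$\Delta=\sum_{j=1}^n\frac{1}{j^{3/2}}\Big(\|\|\mathbb{E}(S_j\mid\mathcal{F}_0)\|_{\mathbb{H}}\|_\infty+\|\|S_j-\mathbb{E}(S_j\mid\mathcal{F}_j)\|_{\mathbb{H}}\|_\infty\Big),$$ and the right-hand side is read as $0$ if $\|\|X_0\|_{\mathbb{H}}\|_\infty+C\Delta=0$. -/

import Mathlib

open MeasureTheory ProbabilityTheory
open scoped ENNReal

universe u v

noncomputable section

namespace HilbertHoeffding

variable {Ω : Type u} {H : Type v}

/-- The stationary sequence `X_i = X₀ ∘ T^i`, `i ∈ ℤ`, generated by a bijection `T` of `Ω`. -/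
def seq (T : Equiv.Perm Ω) (X₀ : Ω → H) (i : ℤ) : Ω → H :=
  fun ω => X₀ ((T ^ i) ω)

/-- The partial sums `S_n = X_1 + ⋯ + X_n` of the stationary sequence. -/
def partialSum [AddCommMonoid H] (T : Equiv.Perm Ω) (X₀ : Ω → H) (n : ℕ) : Ω → H :=
  fun ω => ∑ j ∈ Finset.Icc 1 n, seq T X₀ (j : ℤ) ω

/-- The σ-fields `F_i = T^{-i}(F₀)`, consisting of the preimages of the sets of `F₀` under `T^i`. -/
@[reducible] def filt (T : Equiv.Perm Ω) (F₀ : MeasurableSpace Ω) (i : ℤ) : MeasurableSpace Ω :=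
  F₀.comap (T ^ i : Equiv.Perm Ω)

/-- The norm `‖‖Y‖_H‖_∞`, as a real number; it is used only for essentially bounded `Y`. -/
def linfNorm [NormedAddCommGroup H] [MeasurableSpace Ω] (P : Measure Ω) (Y : Ω → H) : ℝ :=
  (eLpNorm Y ∞ P).toReal

/-- `Δ = ∑_{j=1}^n j^{-3/2} (‖‖E(S_j | F₀)‖_H‖_∞ + ‖‖S_j - E(S_j | F_j)‖_H‖_∞)`. -/
def delta [NormedAddCommGroup H] [NormedSpace ℝ H] [CompleteSpace H]
    (F₀ : MeasurableSpace Ω) [MeasurableSpace Ω] (P : Measure Ω)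
    (T : Equiv.Perm Ω) (X₀ : Ω → H) (n : ℕ) : ℝ :=
  ∑ j ∈ Finset.Icc 1 n, (1 / (j : ℝ) ^ (3 / 2 : ℝ)) *
    (linfNorm P (P[partialSum T X₀ j | F₀]) +
      linfNorm P (partialSum T X₀ j - P[partialSum T X₀ j | filt T F₀ (j : ℤ)]))

/-- The event `max_{1 ≤ i ≤ n} ‖S_i‖_H ≥ x`. -/
def maxEvent [NormedAddCommGroup H] (T : Equiv.Perm Ω) (X₀ : Ω → H)
    (n : ℕ) (hn : 1 ≤ n) (x : ℝ) : Set Ω :=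
  {ω | x ≤ (Finset.Icc 1 n).sup' (Finset.nonempty_Icc.mpr hn) (fun i => ‖partialSum T X₀ i ω‖)}

end HilbertHoeffding

end

/-!
The maximum of the partial sums is estimated in the Orlicz norm of `exp (y ^ 2) - 1`, normalised so
that norm at most `K` means `E exp ((Y / K) ^ 2) ≤ 3` (`GaussNormLE`). This norm satisfies the
triangle inequality, constants have norm at most their absolute value, and Markov's inequality turns
norm `K` into the tail `3 exp (-(x / K) ^ 2)`, where `3 ≤ 2 √e`. It is therefore enough to show that
`max ‖S_i‖` has norm at most `2 √n (‖‖X₀‖‖_∞ + C Δ)`.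

For a martingale in a Hilbert space with `n` differences bounded by `b`, the maximum has norm at most
`2 √n b`. This is Pinelis' inequality: convexity of `s ↦ cosh √s` gives
`cosh ‖x + d‖ ≤ cosh b cosh ‖x‖ + (linear in d)` for `‖d‖ ≤ b`, so that
`E cosh ‖M_n‖ ≤ (cosh b) ^ n ≤ exp (n b ^ 2 / 2)`, and `cosh ‖M‖` is a submartingale, to which Doob's
maximal inequality applies.

The partial sums are reduced to martingales along dyadic blocks. Write `V` for the sum over a block of
times from `s` to `s + h`, and `R = V - E(V | F_{s+h}) + E(V | F_s)` for its remainder, which is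
bounded by `c_h = ‖‖S_h - E(S_h | F_h)‖‖_∞ + ‖‖E(S_h | F_0)‖‖_∞`. Each `X_i` is the martingale difference
`E(X_i | F_i) - E(X_i | F_{i-1})`, bounded by `‖‖X₀‖‖_∞ + ‖‖E(X_1 | F_0)‖‖_∞`, plus the remainder of its
block of length one. The remainders of two adjacent blocks of length `h` add up to the remainder of
their union plus a martingale difference bounded by `2 c_h` (`IsBlockProcess.blockRem_add`). Iterating
until one block is left bounds the norm of the maximum by
`2 √n (‖‖X₀‖‖_∞ + c_1 + 2 ∑_r 2 ^ (-r/2) c_{2^r})` with `2 ^ r ≤ n`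
(`IsBlockProcess.gaussNormLE_maxNorm`).

Finally `c_{i+j} ≤ 2 (c_i + c_j)`, so that `c_{2^r}` is at most a multiple of the average of the earlier
`c_j`, and the dyadic sum is at most a multiple of `Δ` (`sum_dyadic_le`).
-/

namespace HilbertHoeffding

/-! ### A Gaussian Orlicz norm -/

section GaussNorm

open Filter Topology

variable {Ω : Type*} {mΩ : MeasurableSpace Ω} {P : Measure Ω}

/-- The Orlicz norm of `Y` for the Young function `exp (y ^ 2) - 1`, normalised by
`E exp ((Y / K) ^ 2) ≤ 3`, is at most `K`. The moment is required at every scale `L > K` rather than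
at `K` itself, so that `K = 0` is meaningful and says that `Y = 0` almost surely. -/
def GaussNormLE (P : Measure Ω) (Y : Ω → ℝ) (K : ℝ) : Prop :=
  ∀ L, K < L → ∫⁻ ω, ENNReal.ofReal (Real.exp ((Y ω / L) ^ 2)) ∂P ≤ 3

lemma GaussNormLE.mono {Y Z : Ω → ℝ} {K K' : ℝ} (hZ : GaussNormLE P Z K)
    (hYZ : ∀ᵐ ω ∂P, |Y ω| ≤ |Z ω|) (hK : K ≤ K') : GaussNormLE P Y K' := by
  intro L hL
  refine le_trans (lintegral_mono_ae ?_) (hZ L (hK.trans_lt hL))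
  filter_upwards [hYZ] with ω hω
  refine ENNReal.ofReal_le_ofReal (Real.exp_le_exp.2 (sq_le_sq.2 ?_))
  rw [abs_div, abs_div]
  gcongr

/-- The triangle inequality, from the convexity of `y ↦ exp (y ^ 2)`. -/
lemma GaussNormLE.add {Y Z : Ω → ℝ} {K K' : ℝ} (hY : GaussNormLE P Y K) (hZ : GaussNormLE P Z K')
    (hYm : AEMeasurable Y P) (hK : 0 ≤ K) (hK' : 0 ≤ K') :
    GaussNormLE P (fun ω => Y ω + Z ω) (K + K') := by
  intro L hL
  -- The slack `L - (K + K')` is shared out, so that both moments are taken above their threshold.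
  set δ := (L - (K + K')) / 2 with hδ
  have hδ0 : 0 < δ := by rw [hδ]; linarith
  set A := K + δ with hA
  set B := K' + δ with hB
  have hA0 : 0 < A := by positivity
  have hB0 : 0 < B := by positivity
  have hLAB : L = A + B := by rw [hA, hB, hδ]; ring
  have hL0 : 0 < L := by rw [hLAB]; positivity
  have key : ∀ y z : ℝ, Real.exp (((y + z) / L) ^ 2) ≤
      A / L * Real.exp ((y / A) ^ 2) + B / L * Real.exp ((z / B) ^ 2) := by
    intro y z
    have hsum : A / L + B / L = 1 := by rw [← add_div, ← hLAB, div_self hL0.ne']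
    have h1 : (y + z) / L = A / L * (y / A) + B / L * (z / B) := by field_simp
    have h2 := (even_two.convexOn_pow (𝕜 := ℝ)).2 (Set.mem_univ (y / A)) (Set.mem_univ (z / B))
      (by positivity : 0 ≤ A / L) (by positivity : 0 ≤ B / L) hsum
    have h3 := convexOn_exp.2 (Set.mem_univ ((y / A) ^ 2)) (Set.mem_univ ((z / B) ^ 2))
      (by positivity : 0 ≤ A / L) (by positivity : 0 ≤ B / L) hsum
    simp only [smul_eq_mul] at h2 h3
    rw [h1]
    exact (Real.exp_le_exp.2 h2).trans h3
  have e1 : A / L + B / L = 1 := by rw [← add_div, ← hLAB, div_self hL0.ne']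
  calc ∫⁻ ω, ENNReal.ofReal (Real.exp (((Y ω + Z ω) / L) ^ 2)) ∂P
      ≤ ∫⁻ ω, (ENNReal.ofReal (A / L) * ENNReal.ofReal (Real.exp ((Y ω / A) ^ 2)) +
          ENNReal.ofReal (B / L) * ENNReal.ofReal (Real.exp ((Z ω / B) ^ 2))) ∂P := by
        refine lintegral_mono fun ω => ?_
        rw [← ENNReal.ofReal_mul (by positivity), ← ENNReal.ofReal_mul (by positivity),
          ← ENNReal.ofReal_add (by positivity) (by positivity)]
        exact ENNReal.ofReal_le_ofReal (key _ _)
    _ = ENNReal.ofReal (A / L) * ∫⁻ ω, ENNReal.ofReal (Real.exp ((Y ω / A) ^ 2)) ∂P +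
          ENNReal.ofReal (B / L) * ∫⁻ ω, ENNReal.ofReal (Real.exp ((Z ω / B) ^ 2)) ∂P := by
        rw [lintegral_add_left' (by fun_prop), lintegral_const_mul' _ _ ENNReal.ofReal_ne_top,
          lintegral_const_mul' _ _ ENNReal.ofReal_ne_top]
    _ ≤ ENNReal.ofReal (A / L) * 3 + ENNReal.ofReal (B / L) * 3 := by
        gcongr
        · exact hY A (by linarith)
        · exact hZ B (by linarith)
    _ = 3 := by
        rw [← add_mul, ← ENNReal.ofReal_add (by positivity) (by positivity), e1]
        simp

lemma gaussNormLE_of_bounded [IsProbabilityMeasure P] {Y : Ω → ℝ} {c : ℝ}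
    (h : ∀ᵐ ω ∂P, |Y ω| ≤ c) : GaussNormLE P Y c := by
  intro L hL
  calc ∫⁻ ω, ENNReal.ofReal (Real.exp ((Y ω / L) ^ 2)) ∂P ≤ ∫⁻ ω, 3 ∂P := by
        refine lintegral_mono_ae ?_
        filter_upwards [h] with ω hω
        have hL0 : 0 < L := ((abs_nonneg _).trans hω).trans_lt hL
        have h1 : (Y ω / L) ^ 2 ≤ 1 := by
          rw [sq_le_one_iff_abs_le_one, abs_div, abs_of_pos hL0, div_le_one hL0]
          exact hω.trans hL.le
        rw [show (3 : ℝ≥0∞) = ENNReal.ofReal 3 by simp]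
        refine ENNReal.ofReal_le_ofReal ((Real.exp_le_exp.2 h1).trans ?_)
        linarith [Real.exp_one_lt_d9]
    _ = 3 := by simp

lemma GaussNormLE.measure_le_of_lt {Y : Ω → ℝ} {K L x : ℝ} (hY : GaussNormLE P Y K)
    (hL : K < L) (hK : 0 ≤ K) (hx : 0 ≤ x) (hYm : AEMeasurable Y P) :
    P {ω | x ≤ Y ω} ≤ ENNReal.ofReal (3 * Real.exp (-(x / L) ^ 2)) := by
  have hL0 : 0 < L := hK.trans_lt hL
  have h1 : ENNReal.ofReal (Real.exp ((x / L) ^ 2)) * P {ω | x ≤ Y ω} ≤ 3 := by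
    refine le_trans ?_ (hY L hL)
    refine le_trans ?_ (mul_meas_ge_le_lintegral₀ (by fun_prop)
    (ENNReal.ofReal (Real.exp ((x / L) ^ 2))))
    refine mul_le_mul' le_rfl (measure_mono ?_)
    intro ω (hω : x ≤ Y ω)
    refine ENNReal.ofReal_le_ofReal (Real.exp_le_exp.2 ?_)
    gcongr
  have hpos : 0 < Real.exp ((x / L) ^ 2) := Real.exp_pos _
  calc P {ω | x ≤ Y ω} ≤ 3 / ENNReal.ofReal (Real.exp ((x / L) ^ 2)) := by
        rw [ENNReal.le_div_iff_mul_le (Or.inl (by simpa using hpos)) (Or.inl ENNReal.ofReal_ne_top),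
          mul_comm]
        exact h1
    _ = ENNReal.ofReal (3 * Real.exp (-(x / L) ^ 2)) := by
        rw [Real.exp_neg, ← div_eq_mul_inv, ENNReal.ofReal_div_of_pos hpos]
        simp

lemma GaussNormLE.measure_le {Y : Ω → ℝ} {K x : ℝ} (hY : GaussNormLE P Y K)
    (hK : 0 < K) (hx : 0 ≤ x) (hYm : AEMeasurable Y P) :
    P {ω | x ≤ Y ω} ≤ ENNReal.ofReal (3 * Real.exp (-(x / K) ^ 2)) := by
  have hlim : Tendsto (fun L : ℝ => ENNReal.ofReal (3 * Real.exp (-(x / L) ^ 2))) (𝓝[>] K)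
      (𝓝 (ENNReal.ofReal (3 * Real.exp (-(x / K) ^ 2)))) := by
    refine ENNReal.tendsto_ofReal (tendsto_nhdsWithin_of_tendsto_nhds (ContinuousAt.tendsto ?_))
    have : ContinuousAt (fun L : ℝ => x / L) K := continuousAt_const.div continuousAt_id hK.ne'
    fun_prop
  exact ge_of_tendsto hlim
    (eventually_mem_nhdsWithin.mono fun L hL => hY.measure_le_of_lt hL hK.le hx hYm)

lemma GaussNormLE.measure_eq_zero {Y : Ω → ℝ} {x : ℝ} (hY : GaussNormLE P Y 0)
    (hx : 0 < x) (hYm : AEMeasurable Y P) : P {ω | x ≤ Y ω} = 0 := by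
  have h1 : Tendsto (fun L : ℝ => x / L) (𝓝[>] 0) atTop := by
    simpa only [div_eq_mul_inv] using tendsto_inv_nhdsGT_zero.const_mul_atTop hx
  have h2 : Tendsto (fun L : ℝ => (x / L) ^ 2) (𝓝[>] 0) atTop :=
    (tendsto_pow_atTop two_ne_zero).comp h1
  have hlim : Tendsto (fun L : ℝ => ENNReal.ofReal (3 * Real.exp (-(x / L) ^ 2))) (𝓝[>] 0)
      (𝓝 0) := by
    simpa using ENNReal.tendsto_ofReal
      ((Real.tendsto_exp_neg_atTop_nhds_zero.comp h2).const_mul 3)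
  exact le_antisymm (ge_of_tendsto hlim (eventually_mem_nhdsWithin.mono fun L hL =>
    hY.measure_le_of_lt hL le_rfl hx.le hYm)) zero_le

/-- A Gaussian tail at scale `L / √2` bounds the exponential moment at scale `L`: by the layer cake
formula the moment is at most `1 + ∫ 2 exp (-2 t) exp t dt = 3`. -/
lemma lintegral_exp_sq_le_three [IsProbabilityMeasure P] {Y : Ω → ℝ} {L : ℝ} (hL : 0 < L)
    (hYm : AEMeasurable Y P) (hY0 : ∀ ω, 0 ≤ Y ω)
    (htail : ∀ x, 0 < x → P {ω | x ≤ Y ω} ≤ ENNReal.ofReal (2 * Real.exp (-(2 * (x / L) ^ 2)))) :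
    ∫⁻ ω, ENNReal.ofReal (Real.exp ((Y ω / L) ^ 2)) ∂P ≤ 3 := by
  have hlc := lintegral_comp_eq_lintegral_meas_le_mul (f := fun ω => (Y ω / L) ^ 2) P
    (g := Real.exp) (ae_of_all _ fun ω => by positivity) (by fun_prop)
    (fun t _ => Real.continuous_exp.intervalIntegrable _ _)
    (ae_of_all _ fun t => (Real.exp_pos t).le)
  have h1 : ∀ ω, ENNReal.ofReal (Real.exp ((Y ω / L) ^ 2)) =
      ENNReal.ofReal (∫ t in (0 : ℝ)..(Y ω / L) ^ 2, Real.exp t) + 1 := by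
    intro ω
    rw [integral_exp, Real.exp_zero, ← ENNReal.ofReal_one, ← ENNReal.ofReal_add]
    · simp
    · have := Real.one_le_exp (sq_nonneg (Y ω / L)); linarith
    · simp
  have h2 : ∫⁻ t in Set.Ioi (0 : ℝ), P {a | t ≤ (Y a / L) ^ 2} * ENNReal.ofReal (Real.exp t) ≤
      ∫⁻ t in Set.Ioi (0 : ℝ), 2 * ENNReal.ofReal (Real.exp (-t)) := by
    refine setLIntegral_mono (by fun_prop) fun t (ht : 0 < t) => ?_
    have hset : {a | t ≤ (Y a / L) ^ 2} ⊆ {a | L * √t ≤ Y a} := by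
      intro a (ha : t ≤ (Y a / L) ^ 2)
      have : √t ≤ Y a / L := Real.sqrt_le_iff.2 ⟨div_nonneg (hY0 a) hL.le, ha⟩
      rwa [le_div_iff₀ hL, mul_comm] at this
    have h3 := (measure_mono hset).trans (htail (L * √t) (by positivity))
    have h4 : (L * √t / L) ^ 2 = t := by
      rw [mul_div_cancel_left₀ _ hL.ne', Real.sq_sqrt ht.le]
    rw [h4] at h3
    calc P {a | t ≤ (Y a / L) ^ 2} * ENNReal.ofReal (Real.exp t)
        ≤ ENNReal.ofReal (2 * Real.exp (-(2 * t))) * ENNReal.ofReal (Real.exp t) := by gcongr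
      _ = 2 * ENNReal.ofReal (Real.exp (-t)) := by
          rw [← ENNReal.ofReal_mul (by positivity), mul_assoc, ← Real.exp_add,
            ENNReal.ofReal_mul (by norm_num)]
          congr 3
          · simp
          · ring
  have h5 : ∫⁻ t in Set.Ioi (0 : ℝ), 2 * ENNReal.ofReal (Real.exp (-t)) = 2 := by
    rw [lintegral_const_mul' _ _ (by simp), ← ofReal_integral_eq_lintegral_ofReal
      (integrableOn_exp_neg_Ioi 0) (ae_of_all _ fun t => (Real.exp_pos _).le),
      integral_exp_neg_Ioi_zero]
    simp
  calc ∫⁻ ω, ENNReal.ofReal (Real.exp ((Y ω / L) ^ 2)) ∂P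
      = ∫⁻ ω, (ENNReal.ofReal (∫ t in (0 : ℝ)..(Y ω / L) ^ 2, Real.exp t) + 1) ∂P := by
        simp_rw [h1]
    _ = (∫⁻ t in Set.Ioi (0 : ℝ),
          P {a | t ≤ (Y a / L) ^ 2} * ENNReal.ofReal (Real.exp t)) + 1 := by
        rw [lintegral_add_right _ measurable_const, hlc, lintegral_one, measure_univ]
    _ ≤ 2 + 1 := add_le_add_left (h2.trans h5.le) 1
    _ = 3 := by norm_num

end GaussNorm

/-! ### The function `cosh ‖x‖` on a Hilbert space -/

section Cosh

/-- Every term of the power series `cosh √s = ∑ s ^ n / (2 n)!` is convex on `[0, ∞)`. -/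
lemma convexOn_cosh_sqrt : ConvexOn ℝ (Set.Ici 0) fun s : ℝ => Real.cosh (√s) := by
  have hs : ∀ s : ℝ, 0 ≤ s → HasSum (fun n : ℕ => s ^ n / (2 * n).factorial) (Real.cosh (√s)) := by
    intro s hs
    simpa only [pow_mul, Real.sq_sqrt hs] using Real.hasSum_cosh (√s)
  refine ⟨convex_Ici 0, fun x hx y hy a b ha hb hab => ?_⟩
  have hx' : 0 ≤ x := hx
  have hy' : 0 ≤ y := hy
  simp only [smul_eq_mul]
  refine hasSum_le (fun n => ?_) (hs (a * x + b * y) (by positivity))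
    (((hs x hx).mul_left a).add ((hs y hy).mul_left b))
  have := (convexOn_pow n).2 hx hy ha hb hab
  simp only [smul_eq_mul] at this
  rw [← mul_div_assoc, ← mul_div_assoc, ← add_div]
  gcongr

variable {H : Type*} [NormedAddCommGroup H] [InnerProductSpace ℝ H]

/-- The gradient of `x ↦ cosh ‖x‖`; at `x = 0` the quotient is `0 / 0 = 0`, which gives the correct
value `0`. -/
noncomputable def coshGrad (x : H) : H := (Real.sinh ‖x‖ / ‖x‖) • x

lemma norm_coshGrad (x : H) : ‖coshGrad x‖ = Real.sinh ‖x‖ := by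
  rcases eq_or_ne x 0 with rfl | hx
  · simp [coshGrad]
  · have : 0 < ‖x‖ := norm_pos_iff.2 hx
    rw [coshGrad, norm_smul, Real.norm_of_nonneg
      (div_nonneg (Real.sinh_nonneg_iff.2 this.le) this.le), div_mul_cancel₀ _ this.ne']

/-- Convexity of `x ↦ cosh ‖x‖`, as the tangent inequality at `x`. -/
lemma cosh_norm_add_inner_le (x d : H) :
    Real.cosh ‖x‖ + inner ℝ (coshGrad x) d ≤ Real.cosh ‖x + d‖ := by
  rcases eq_or_ne x 0 with rfl | hx
  · simp [coshGrad]
  have h0 : 0 < ‖x‖ := norm_pos_iff.2 hx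
  have tangent : ∀ a y : ℝ, Real.cosh a + Real.sinh a * (y - a) ≤ Real.cosh y := by
    intro a y
    have h1 := Real.add_one_le_exp (y - a)
    have h2 := Real.add_one_le_exp (-(y - a))
    have e1 : Real.exp y = Real.exp a * Real.exp (y - a) := by rw [← Real.exp_add]; congr 1; ring
    have e2 : Real.exp (-y) = Real.exp (-a) * Real.exp (-(y - a)) := by
      rw [← Real.exp_add]; congr 1; ring
    rw [Real.cosh_eq, Real.cosh_eq, Real.sinh_eq, e1, e2]
    nlinarith [mul_le_mul_of_nonneg_left h1 (Real.exp_pos a).le,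
      mul_le_mul_of_nonneg_left h2 (Real.exp_pos (-a)).le]
  have h1 : inner ℝ x d / ‖x‖ ≤ ‖x + d‖ - ‖x‖ := by
    rw [div_le_iff₀ h0]
    have := real_inner_le_norm x (x + d)
    rw [inner_add_right, real_inner_self_eq_norm_sq] at this
    nlinarith
  have h2 : inner ℝ (coshGrad x) d = Real.sinh ‖x‖ * (inner ℝ x d / ‖x‖) := by
    rw [coshGrad, real_inner_smul_left]; ring
  rw [h2]
  refine le_trans ?_ (tangent ‖x‖ ‖x + d‖)
  gcongr

/-- One step of the martingale estimate. As `‖x + d‖ ^ 2 ≤ ‖x‖ ^ 2 + b ^ 2 + 2 ⟪x, d⟫` and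
`s ↦ cosh √s` is convex, `cosh ‖x + d‖` lies below the chord through the extreme values
`⟪x, d⟫ = ± ‖x‖ b`, which is affine in `d`. -/
lemma cosh_norm_add_le (x d : H) {b : ℝ} (hd : ‖d‖ ≤ b) :
    Real.cosh ‖x + d‖ ≤
      Real.cosh b * Real.cosh ‖x‖ + Real.sinh b / b * inner ℝ (coshGrad x) d := by
  rcases eq_or_ne x 0 with rfl | hx
  · have hb : 0 ≤ b := (norm_nonneg d).trans hd
    simpa [coshGrad, abs_of_nonneg hb] using hd
  rcases ((norm_nonneg d).trans hd).eq_or_lt with rfl | hb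
  · have : d = 0 := by simpa using hd
    simp [this]
  have h0 : 0 < ‖x‖ := norm_pos_iff.2 hx
  set a := ‖x‖ with ha
  set w := inner ℝ x d with hw
  have hwle : |w| ≤ a * b := (abs_real_inner_le_norm x d).trans (by gcongr)
  have hab : 0 < a * b := by positivity
  -- `⟪x, d⟫ = θ ‖x‖ b`: the point lies at ratio `(1 + θ) / 2` between the two ends of the chord.
  set θ := w / (a * b) with hθ
  have hwθ : w = θ * (a * b) := by rw [hθ, div_mul_cancel₀ _ hab.ne']
  have hθ1 : |θ| ≤ 1 := by rw [hθ, abs_div, abs_of_pos hab, div_le_one hab]; exact hwle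
  obtain ⟨hθl, hθr⟩ := abs_le.1 hθ1
  have hn : ‖x + d‖ ≤ √((1 + θ) / 2 * (a + b) ^ 2 + (1 - θ) / 2 * (a - b) ^ 2) := by
    apply Real.le_sqrt_of_sq_le
    rw [norm_add_sq_real, ← hw, hwθ, ← ha]
    nlinarith [pow_le_pow_left₀ (norm_nonneg d) hd 2]
  have hc := convexOn_cosh_sqrt.2 (sq_nonneg (a + b)) (sq_nonneg (a - b))
    (by linarith : 0 ≤ (1 + θ) / 2) (by linarith : 0 ≤ (1 - θ) / 2) (by ring)
  simp only [smul_eq_mul, Real.sqrt_sq_eq_abs, Real.cosh_abs] at hc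
  have h2 : inner ℝ (coshGrad x) d = Real.sinh a * (w / a) := by
    rw [coshGrad, real_inner_smul_left, ← ha, ← hw]; ring
  calc Real.cosh ‖x + d‖ ≤ _ := by
        rw [Real.cosh_le_cosh, abs_of_nonneg (norm_nonneg _), abs_of_nonneg (Real.sqrt_nonneg _)]
        exact hn
    _ ≤ _ := hc
    _ = _ := by
        rw [h2, Real.cosh_add, Real.cosh_sub, hwθ]
        field_simp
        ring

end Cosh

/-! ### Maximal inequality for bounded martingale differences -/

section Martingale

variable {Ω : Type*} {mΩ : MeasurableSpace Ω} {P : Measure Ω}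
  {H : Type*} [NormedAddCommGroup H]

/-- The maximum over `0 ≤ k ≤ N` of `‖U 0 + ⋯ + U (k - 1)‖`. The empty sum is included, which does
not change the maximum for `N ≥ 1`. -/
noncomputable def maxNorm (U : ℕ → Ω → H) (N : ℕ) (ω : Ω) : ℝ :=
  (Finset.range (N + 1)).sup' Finset.nonempty_range_add_one
    fun k => ‖∑ i ∈ Finset.range k, U i ω‖

lemma le_maxNorm (U : ℕ → Ω → H) {k N : ℕ} (hk : k ≤ N) (ω : Ω) :
    ‖∑ i ∈ Finset.range k, U i ω‖ ≤ maxNorm U N ω :=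
  Finset.le_sup' (fun k => ‖∑ i ∈ Finset.range k, U i ω‖) (Finset.mem_range.2 (by omega))

lemma maxNorm_nonneg (U : ℕ → Ω → H) (N : ℕ) (ω : Ω) : 0 ≤ maxNorm U N ω :=
  (norm_nonneg _).trans (le_maxNorm U (Nat.zero_le N) ω)

lemma aemeasurable_maxNorm {U : ℕ → Ω → H} (hU : ∀ i, AEStronglyMeasurable (U i) P) (N : ℕ) :
    AEMeasurable (maxNorm U N) P := by
  have h : maxNorm U N = (Finset.range (N + 1)).sup' Finset.nonempty_range_add_one
      fun k ω => ‖∑ i ∈ Finset.range k, U i ω‖ := by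
    ext ω; simp [maxNorm, Finset.sup'_apply]
  rw [h]
  refine Finset.sup'_induction (p := fun f => AEMeasurable f P) _ _
    (fun f hf g hg => hf.sup hg) fun k _ => ?_
  exact (Finset.aestronglyMeasurable_fun_sum _ fun i _ => hU i).norm.aemeasurable

variable [InnerProductSpace ℝ H]

/-- `D` is a sequence of martingale differences, bounded by `b` almost surely; `D i` is measurable at
time `i + 1` and centred given time `i`. -/
structure IsBoundedMartingaleDifference (P : Measure Ω) (𝒢 : Filtration ℕ mΩ) (D : ℕ → Ω → H)
    (b : ℝ) : Prop where
  stronglyMeasurable : ∀ i, StronglyMeasurable[𝒢 (i + 1)] (D i)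
  norm_le : ∀ i, ∀ᵐ ω ∂P, ‖D i ω‖ ≤ b
  condExp_eq_zero : ∀ i, P[D i | 𝒢 i] =ᵐ[P] 0

namespace IsBoundedMartingaleDifference

variable {𝒢 : Filtration ℕ mΩ} {D : ℕ → Ω → H} {b : ℝ}

lemma const_smul [CompleteSpace H] (h : IsBoundedMartingaleDifference P 𝒢 D b) (c : ℝ) (hc : 0 ≤ c) :
    IsBoundedMartingaleDifference P 𝒢 (fun i => c • D i) (c * b) where
  stronglyMeasurable i := (h.stronglyMeasurable i).const_smul c
  norm_le i := by
    filter_upwards [h.norm_le i] with ω hω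
    rw [Pi.smul_apply, norm_smul, Real.norm_of_nonneg hc]
    gcongr
  condExp_eq_zero i := by
    filter_upwards [condExp_smul c (D i) (𝒢 i) (μ := P), h.condExp_eq_zero i] with ω h1 h2
    rw [h1, Pi.smul_apply, h2]
    simp

lemma stronglyMeasurable_sum (h : IsBoundedMartingaleDifference P 𝒢 D b) (k : ℕ) :
    StronglyMeasurable[𝒢 k] fun ω => ∑ i ∈ Finset.range k, D i ω := by
  refine Finset.stronglyMeasurable_fun_sum _ fun i hi => ?_
  exact (h.stronglyMeasurable i).mono (𝒢.mono (Finset.mem_range.1 hi))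

lemma norm_sum_le (h : IsBoundedMartingaleDifference P 𝒢 D b) (k : ℕ) :
    ∀ᵐ ω ∂P, ‖∑ i ∈ Finset.range k, D i ω‖ ≤ k * b := by
  filter_upwards [ae_all_iff.2 h.norm_le] with ω hω
  refine (norm_sum_le_of_le _ fun i _ => hω i).trans ?_
  simp

lemma integrable_cosh [IsProbabilityMeasure P] (h : IsBoundedMartingaleDifference P 𝒢 D b) (k : ℕ) :
    Integrable (fun ω => Real.cosh ‖∑ i ∈ Finset.range k, D i ω‖) P := by
  refine Integrable.of_bound (C := Real.cosh (k * b)) ?_ ?_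
  · exact (Real.continuous_cosh.comp_stronglyMeasurable
      ((h.stronglyMeasurable_sum k).mono (𝒢.le k)).norm).aestronglyMeasurable
  · filter_upwards [h.norm_sum_le k] with ω hω
    rw [Real.norm_of_nonneg (Real.cosh_pos _).le, Real.cosh_le_cosh, abs_norm]
    exact hω.trans (le_abs_self _)

lemma integrable [IsProbabilityMeasure P] (h : IsBoundedMartingaleDifference P 𝒢 D b) (k : ℕ) : Integrable (D k) P :=
  Integrable.of_bound ((h.stronglyMeasurable k).mono (𝒢.le _)).aestronglyMeasurable b (h.norm_le k)

lemma stronglyMeasurable_coshGrad (h : IsBoundedMartingaleDifference P 𝒢 D b) (k : ℕ) :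
    StronglyMeasurable[𝒢 k] fun ω => coshGrad (∑ i ∈ Finset.range k, D i ω) := by
  have h1 := (h.stronglyMeasurable_sum k)
  refine StronglyMeasurable.smul (𝕜 := ℝ) ?_ h1
  exact ((Real.continuous_sinh.measurable.comp h1.norm.measurable).div
    h1.norm.measurable).stronglyMeasurable

lemma integrable_inner [IsProbabilityMeasure P] (h : IsBoundedMartingaleDifference P 𝒢 D b) (k : ℕ) :
    Integrable (fun ω => inner ℝ (coshGrad (∑ i ∈ Finset.range k, D i ω)) (D k ω)) P := by
  refine Integrable.of_bound (C := Real.sinh (k * b) * b) ?_ ?_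
  · exact (((h.stronglyMeasurable_coshGrad k).mono (𝒢.le k)).inner
      ((h.stronglyMeasurable k).mono (𝒢.le _))).aestronglyMeasurable
  · filter_upwards [h.norm_sum_le k, h.norm_le k] with ω h1 h2
    refine (norm_inner_le_norm _ _).trans ?_
    rw [norm_coshGrad]
    gcongr
    · exact Real.sinh_nonneg_iff.2 ((norm_nonneg _).trans h1)
    · exact Real.sinh_le_sinh.2 h1

lemma condExp_inner [IsProbabilityMeasure P] [CompleteSpace H]
    (h : IsBoundedMartingaleDifference P 𝒢 D b) (k : ℕ) :
    P[fun ω => inner ℝ (coshGrad (∑ i ∈ Finset.range k, D i ω)) (D k ω) | 𝒢 k] =ᵐ[P] 0 := by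
  have h1 := condExp_bilin_of_stronglyMeasurable_left (innerSL ℝ) (h.stronglyMeasurable_coshGrad k)
    (h.integrable_inner k) (h.integrable k)
  filter_upwards [h1, h.condExp_eq_zero k] with ω h2 h3
  exact h2.trans (by simp [h3])

lemma submartingale_cosh [IsProbabilityMeasure P] [CompleteSpace H]
    (h : IsBoundedMartingaleDifference P 𝒢 D b) :
    Submartingale (fun k ω => Real.cosh ‖∑ i ∈ Finset.range k, D i ω‖) 𝒢 P := by
  have hm : ∀ k, StronglyMeasurable[𝒢 k] fun ω => Real.cosh ‖∑ i ∈ Finset.range k, D i ω‖ :=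
    fun k => Real.continuous_cosh.comp_stronglyMeasurable (h.stronglyMeasurable_sum k).norm
  refine submartingale_nat hm h.integrable_cosh fun k => ?_
  have h1 := condExp_mono (m := 𝒢 k) ((h.integrable_cosh k).add (h.integrable_inner k))
    (h.integrable_cosh (k + 1)) (ae_of_all _ fun ω => by
      simp only [Finset.sum_range_succ]; exact cosh_norm_add_inner_le _ _)
  filter_upwards [h1, condExp_add (h.integrable_cosh k) (h.integrable_inner k) (𝒢 k),
    h.condExp_inner k] with ω h1 h2 h3
  rw [h2, Pi.add_apply, h3, condExp_of_stronglyMeasurable (𝒢.le k) (hm k) (h.integrable_cosh k)]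
    at h1
  simpa using h1

lemma integral_cosh_le [IsProbabilityMeasure P] [CompleteSpace H]
    (h : IsBoundedMartingaleDifference P 𝒢 D b) (k : ℕ) :
    ∫ ω, Real.cosh ‖∑ i ∈ Finset.range k, D i ω‖ ∂P ≤ Real.cosh b ^ k := by
  induction k with
  | zero => simp
  | succ k ih =>
    have h0 : ∫ ω, inner ℝ (coshGrad (∑ i ∈ Finset.range k, D i ω)) (D k ω) ∂P = 0 := by
      rw [← integral_condExp (𝒢.le k), integral_congr_ae (h.condExp_inner k)]
      simp
    calc ∫ ω, Real.cosh ‖∑ i ∈ Finset.range (k + 1), D i ω‖ ∂P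
        ≤ ∫ ω, (Real.cosh b * Real.cosh ‖∑ i ∈ Finset.range k, D i ω‖ + Real.sinh b / b *
            inner ℝ (coshGrad (∑ i ∈ Finset.range k, D i ω)) (D k ω)) ∂P := by
          refine integral_mono_ae (h.integrable_cosh _) (((h.integrable_cosh k).const_mul _).add
            ((h.integrable_inner k).const_mul _)) ?_
          filter_upwards [h.norm_le k] with ω hω
          simp only [Finset.sum_range_succ]
          exact cosh_norm_add_le _ _ hω
      _ = Real.cosh b * ∫ ω, Real.cosh ‖∑ i ∈ Finset.range k, D i ω‖ ∂P := by
          rw [integral_add ((h.integrable_cosh k).const_mul _)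
            ((h.integrable_inner k).const_mul _), integral_const_mul, integral_const_mul, h0]
          ring
      _ ≤ Real.cosh b ^ (k + 1) := by
          rw [pow_succ']
          have := (Real.cosh_pos b).le
          gcongr

lemma measure_cosh_le [IsProbabilityMeasure P] [CompleteSpace H]
    (h : IsBoundedMartingaleDifference P 𝒢 D b) (N : ℕ) {x : ℝ} (hx : 0 ≤ x) :
    ENNReal.ofReal (Real.cosh x) * P {ω | x ≤ maxNorm D N ω} ≤
      ENNReal.ofReal (Real.cosh b ^ N) := by
  have h1 := maximal_ineq h.submartingale_cosh (fun k ω => (Real.cosh_pos _).le)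
    (ε := (Real.cosh x).toNNReal) N
  rw [Real.coe_toNNReal _ (Real.cosh_pos x).le] at h1
  refine le_trans ?_ (h1.trans (ENNReal.ofReal_le_ofReal ?_))
  · refine mul_le_mul' le_rfl (measure_mono fun ω (hω : x ≤ maxNorm D N ω) => ?_)
    rw [maxNorm, Finset.le_sup'_iff] at hω
    obtain ⟨k, hk, hk'⟩ := hω
    refine (Finset.le_sup'_iff (α := ℝ) _).2 ⟨k, hk, ?_⟩
    rw [Real.cosh_le_cosh, abs_of_nonneg hx, abs_norm]
    exact hk'
  · exact (setIntegral_le_integral (h.integrable_cosh N)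
      (ae_of_all _ fun ω => (Real.cosh_pos _).le)).trans (h.integral_cosh_le N)

/-- Pinelis' inequality: Doob's inequality for the submartingale `cosh ‖l • M‖`, with the optimal
parameter `l = x / v`. -/
lemma measure_maxNorm_le [IsProbabilityMeasure P] [CompleteSpace H]
    (h : IsBoundedMartingaleDifference P 𝒢 D b) (N : ℕ) {v x : ℝ}
    (hv : 0 < v) (hNv : N * b ^ 2 ≤ v) (hx : 0 < x) :
    P {ω | x ≤ maxNorm D N ω} ≤ ENNReal.ofReal (2 * Real.exp (-(x ^ 2 / (2 * v)))) := by
  set l := x / v with hl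
  have hl0 : 0 < l := by positivity
  have h1 := (h.const_smul l hl0.le).measure_cosh_le N (x := l * x) (by positivity)
  have hset : {ω | l * x ≤ maxNorm (fun i => l • D i) N ω} = {ω | x ≤ maxNorm D N ω} := by
    ext ω
    simp only [maxNorm, Set.mem_ofPred_eq, Finset.le_sup'_iff, Pi.smul_apply, ← Finset.smul_sum,
      norm_smul, Real.norm_of_nonneg hl0.le, mul_le_mul_iff_right₀ hl0]
  rw [hset] at h1
  have hc : Real.exp (l * x) / 2 ≤ Real.cosh (l * x) := by
    rw [Real.cosh_eq]; have := Real.exp_pos (-(l * x)); linarith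
  have hb : Real.cosh (l * b) ^ N ≤ Real.exp (l ^ 2 * v / 2) := by
    calc Real.cosh (l * b) ^ N ≤ Real.exp ((l * b) ^ 2 / 2) ^ N := by
          gcongr
          · exact Real.cosh_le_exp_half_sq _
      _ = Real.exp (l ^ 2 * (N * b ^ 2) / 2) := by rw [← Real.exp_nat_mul]; congr 1; ring
      _ ≤ _ := by gcongr
  have hpos : 0 < Real.exp (l * x) / 2 := by positivity
  have h2 : ENNReal.ofReal (Real.exp (l * x) / 2) * P {ω | x ≤ maxNorm D N ω} ≤
      ENNReal.ofReal (Real.exp (l ^ 2 * v / 2)) :=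
    (mul_le_mul' (ENNReal.ofReal_le_ofReal hc) le_rfl).trans
      (h1.trans (ENNReal.ofReal_le_ofReal hb))
  calc P {ω | x ≤ maxNorm D N ω}
      ≤ ENNReal.ofReal (Real.exp (l ^ 2 * v / 2)) / ENNReal.ofReal (Real.exp (l * x) / 2) := by
        rw [ENNReal.le_div_iff_mul_le (Or.inl (by simpa using Real.exp_pos _))
          (Or.inl ENNReal.ofReal_ne_top), mul_comm]
        exact h2
    _ = _ := by
        rw [← ENNReal.ofReal_div_of_pos hpos, div_div_eq_mul_div, mul_comm, mul_div_assoc,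
          ← Real.exp_sub]
        congr 3
        rw [hl]
        field_simp
        ring

lemma gaussNormLE_maxNorm [IsProbabilityMeasure P] [CompleteSpace H]
    (h : IsBoundedMartingaleDifference P 𝒢 D b) (N : ℕ) (hb : 0 ≤ b) :
    GaussNormLE P (maxNorm D N) (2 * √N * b) := by
  intro L hL
  have hL0 : 0 < L := lt_of_le_of_lt (by positivity) hL
  refine lintegral_exp_sq_le_three hL0 (aemeasurable_maxNorm
    (fun i => ((h.stronglyMeasurable i).mono (𝒢.le _)).aestronglyMeasurable) N)
    (maxNorm_nonneg D N) fun x hx => ?_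
  refine (h.measure_maxNorm_le N (v := L ^ 2 / 4) (by positivity) ?_ hx).trans (le_of_eq ?_)
  · have h1 : (2 * √N * b) ^ 2 ≤ L ^ 2 := by gcongr
    rw [mul_pow, mul_pow, Real.sq_sqrt (Nat.cast_nonneg N)] at h1
    linarith
  · congr 4
    field_simp
    norm_num

end IsBoundedMartingaleDifference

end Martingale

/-! ### Dyadic martingale approximation of block sums -/

section Dyadic

variable {Ω : Type*} {mΩ : MeasurableSpace Ω} {P : Measure Ω}
  {H : Type*} [NormedAddCommGroup H] [InnerProductSpace ℝ H]

/-- The filtration observed at the times `0, m, 2 m, …`. -/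
def subFiltration (𝒢 : Filtration ℕ mΩ) (m : ℕ) : Filtration ℕ mΩ where
  seq i := 𝒢 (i * m)
  mono' _ _ hij := 𝒢.mono (Nat.mul_le_mul_right m hij)
  le' i := 𝒢.le (i * m)

/-- `V s h` plays the role of the sum over the block of times `s + 1, …, s + h`. It is additive over
adjacent blocks; `p h` bounds the error of predicting it from the end of the block, and `q h` bounds
its prediction from the start of the block, both uniformly in `s`. -/
structure IsBlockProcess (P : Measure Ω) (𝒢 : Filtration ℕ mΩ) (V : ℕ → ℕ → Ω → H)
    (p q : ℕ → ℝ) : Prop where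
  integrable : ∀ s h, Integrable (V s h) P
  add : ∀ s h h', V s (h + h') = V s h + V (s + h) h'
  norm_sub_condExp_le : ∀ s h, ∀ᵐ ω ∂P, ‖V s h ω - P[V s h | 𝒢 (s + h)] ω‖ ≤ p h
  norm_condExp_le : ∀ s h, ∀ᵐ ω ∂P, ‖P[V s h | 𝒢 s] ω‖ ≤ q h
  nonneg_left : ∀ h, 0 ≤ p h
  nonneg_right : ∀ h, 0 ≤ q h

/-- The part of a block sum left after removing the martingale differences of its own and all finer
scales. -/
noncomputable def blockRem (P : Measure Ω) (𝒢 : Filtration ℕ mΩ) (V : ℕ → ℕ → Ω → H)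
    (h s : ℕ) : Ω → H :=
  V s h - P[V s h | 𝒢 (s + h)] + P[V s h | 𝒢 s]

/-- The martingale difference split off when the remainders of two adjacent blocks of length `h` are
merged into the remainder of the block of length `2 h`. -/
noncomputable def blockDiff (P : Measure Ω) (𝒢 : Filtration ℕ mΩ) (V : ℕ → ℕ → Ω → H)
    (h s : ℕ) : Ω → H :=
  (P[V s h | 𝒢 (s + (h + h))] - P[V s h | 𝒢 (s + h)]) +
    (P[V (s + h) h | 𝒢 (s + h)] - P[V (s + h) h | 𝒢 s])

namespace IsBlockProcess

variable {𝒢 : Filtration ℕ mΩ} {V : ℕ → ℕ → Ω → H} {p q : ℕ → ℝ}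

lemma norm_blockRem_le (hV : IsBlockProcess P 𝒢 V p q) (h s : ℕ) :
    ∀ᵐ ω ∂P, ‖blockRem P 𝒢 V h s ω‖ ≤ p h + q h := by
  filter_upwards [hV.norm_sub_condExp_le s h, hV.norm_condExp_le s h] with ω h1 h2
  exact (norm_add_le _ _).trans (add_le_add h1 h2)

lemma aestronglyMeasurable_blockRem [CompleteSpace H] (hV : IsBlockProcess P 𝒢 V p q) (h s : ℕ) :
    AEStronglyMeasurable (blockRem P 𝒢 V h s) P :=
  ((hV.integrable s h).sub integrable_condExp).aestronglyMeasurable.add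
    integrable_condExp.aestronglyMeasurable

lemma blockRem_add [CompleteSpace H] (hV : IsBlockProcess P 𝒢 V p q) (h s : ℕ) :
    ∀ᵐ ω ∂P, blockRem P 𝒢 V h s ω + blockRem P 𝒢 V h (s + h) ω =
      blockDiff P 𝒢 V h s ω + blockRem P 𝒢 V (h + h) s ω := by
  filter_upwards [condExp_add (hV.integrable s h) (hV.integrable (s + h) h) (𝒢 s),
    condExp_add (hV.integrable s h) (hV.integrable (s + h) h) (𝒢 (s + (h + h)))] with ω h1 h2
  simp only [blockRem, blockDiff, hV.add s h h, Pi.add_apply, Pi.sub_apply, h1, h2]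
  rw [add_assoc s h h]
  abel

/-- Merging blocks in pairs: an even number of remainders regroups exactly, and for an odd number
one bounded remainder is left over. -/
lemma maxNorm_blockRem_le [CompleteSpace H] (hV : IsBlockProcess P 𝒢 V p q) (h N : ℕ) :
    ∀ᵐ ω ∂P, maxNorm (fun i => blockRem P 𝒢 V h (i * h)) N ω ≤
      maxNorm (fun i => blockDiff P 𝒢 V h (i * (h + h))) (N / 2) ω +
      maxNorm (fun i => blockRem P 𝒢 V (h + h) (i * (h + h))) (N / 2) ω + (p h + q h) := by
  filter_upwards [ae_all_iff.2 fun i => hV.blockRem_add h (i * (h + h)),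
    ae_all_iff.2 fun i => hV.norm_blockRem_le h (i * h)] with ω h1 h2
  have heven : ∀ k, ∑ i ∈ Finset.range (2 * k), blockRem P 𝒢 V h (i * h) ω =
      ∑ i ∈ Finset.range k, blockDiff P 𝒢 V h (i * (h + h)) ω +
      ∑ i ∈ Finset.range k, blockRem P 𝒢 V (h + h) (i * (h + h)) ω := by
    intro k
    induction k with
    | zero => simp
    | succ k ih =>
      rw [Finset.sum_range_succ _ k, Finset.sum_range_succ _ k,
        show 2 * (k + 1) = 2 * k + 1 + 1 by ring, Finset.sum_range_succ, Finset.sum_range_succ, ih,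
        add_assoc, show 2 * k * h = k * (h + h) by ring,
        show (2 * k + 1) * h = k * (h + h) + h by ring, h1 k]
      abel
  have hle : ∀ k, 2 * k ≤ N → ‖∑ i ∈ Finset.range (2 * k), blockRem P 𝒢 V h (i * h) ω‖ ≤
      maxNorm (fun i => blockDiff P 𝒢 V h (i * (h + h))) (N / 2) ω +
      maxNorm (fun i => blockRem P 𝒢 V (h + h) (i * (h + h))) (N / 2) ω := by
    intro k hk
    rw [heven]
    exact (norm_add_le _ _).trans (add_le_add (le_maxNorm _ (by omega) ω)
      (le_maxNorm (fun i => blockRem P 𝒢 V (h + h) (i * (h + h))) (by omega) ω))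
  refine Finset.sup'_le _ _ fun k hk => ?_
  have hk' : k ≤ N := Nat.lt_succ_iff.1 (Finset.mem_range.1 hk)
  rcases Nat.even_or_odd' k with ⟨j, rfl | rfl⟩
  · have := hV.nonneg_left h
    have := hV.nonneg_right h
    linarith [hle j hk']
  · rw [Finset.sum_range_succ]
    exact (norm_add_le _ _).trans (add_le_add (hle j (by omega)) (h2 _))

variable [IsProbabilityMeasure P] [CompleteSpace H]

lemma norm_condExp_sub_condExp_le (hV : IsBlockProcess P 𝒢 V p q) (s h : ℕ) {t : ℕ}
    (ht : s + h ≤ t) : ∀ᵐ ω ∂P, ‖P[V s h | 𝒢 t] ω - P[V s h | 𝒢 (s + h)] ω‖ ≤ p h := by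
  have h1 := ae_bdd_norm_condExp_of_ae_bdd_norm (m := 𝒢 t) (hV.norm_sub_condExp_le s h)
  have h2 := condExp_sub (hV.integrable s h) (integrable_condExp (m := 𝒢 (s + h)) (f := V s h)
    (μ := P)) (𝒢 t)
  rw [condExp_of_stronglyMeasurable (𝒢.le t)
    (stronglyMeasurable_condExp.mono (𝒢.mono ht)) integrable_condExp] at h2
  filter_upwards [h1, h2] with ω h1 h2
  rw [Pi.sub_apply] at h2
  rw [← h2]
  exact h1

lemma norm_condExp_le_of_le (hV : IsBlockProcess P 𝒢 V p q) (s h : ℕ) {t : ℕ}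
    (ht : t ≤ s) : ∀ᵐ ω ∂P, ‖P[V s h | 𝒢 t] ω‖ ≤ q h := by
  have h1 := ae_bdd_norm_condExp_of_ae_bdd_norm (m := 𝒢 t) (hV.norm_condExp_le s h)
  filter_upwards [h1, condExp_condExp_of_le (f := V s h) (μ := P) (𝒢.mono ht) (𝒢.le s)] with ω h1 h2
  rwa [h2] at h1

lemma norm_condExp_add_le (hV : IsBlockProcess P 𝒢 V p q) (s h h' : ℕ) :
    ∀ᵐ ω ∂P, ‖P[V s (h + h') | 𝒢 s] ω‖ ≤ q h + q h' := by
  rw [hV.add]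
  filter_upwards [condExp_add (hV.integrable s h) (hV.integrable (s + h) h') (𝒢 s),
    hV.norm_condExp_le s h, hV.norm_condExp_le_of_le (s + h) h' (Nat.le_add_right s h)]
    with ω h1 h2 h3
  rw [h1, Pi.add_apply]
  exact (norm_add_le _ _).trans (add_le_add h2 h3)

/-- The factor `2` arises because `f - P[f | m]`, unlike `P[f | m]`, is not a contraction of `f` in
`L^∞`. -/
lemma norm_sub_condExp_add_le (hV : IsBlockProcess P 𝒢 V p q) (s h h' : ℕ) :
    ∀ᵐ ω ∂P, ‖V s (h + h') ω - P[V s (h + h') | 𝒢 (s + (h + h'))] ω‖ ≤ 2 * p h + p h' := by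
  rw [hV.add, ← add_assoc]
  filter_upwards [condExp_add (hV.integrable s h) (hV.integrable (s + h) h') (𝒢 (s + h + h')),
    hV.norm_sub_condExp_le s h, hV.norm_sub_condExp_le (s + h) h',
    hV.norm_condExp_sub_condExp_le s h (Nat.le_add_right (s + h) h')] with ω h1 h2 h3 h4
  rw [h1, Pi.add_apply, Pi.add_apply]
  have e : V s h ω + V (s + h) h' ω -
      (P[V s h | 𝒢 (s + h + h')] ω + P[V (s + h) h' | 𝒢 (s + h + h')] ω) =
      (V s h ω - P[V s h | 𝒢 (s + h)] ω) -
        (P[V s h | 𝒢 (s + h + h')] ω - P[V s h | 𝒢 (s + h)] ω) +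
        (V (s + h) h' ω - P[V (s + h) h' | 𝒢 (s + h + h')] ω) := by abel
  rw [e]
  calc _ ≤ p h + p h + p h' :=
        (norm_add_le _ _).trans (add_le_add ((norm_sub_le _ _).trans (add_le_add h2 h4)) h3)
    _ = _ := by ring

lemma isBoundedMartingaleDifference_blockDiff (hV : IsBlockProcess P 𝒢 V p q) (h : ℕ) :
    IsBoundedMartingaleDifference P (subFiltration 𝒢 (h + h))
      (fun i => blockDiff P 𝒢 V h (i * (h + h))) (p h + 2 * q h) where
  stronglyMeasurable i := by
    change StronglyMeasurable[𝒢 ((i + 1) * (h + h))] _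
    rw [add_one_mul]
    set s := i * (h + h)
    have hm : ∀ {f : Ω → H} {t : ℕ}, t ≤ s + (h + h) →
        StronglyMeasurable[𝒢 (s + (h + h))] (P[f | 𝒢 t]) :=
      fun ht => stronglyMeasurable_condExp.mono (𝒢.mono ht)
    exact ((hm le_rfl).sub (hm (by omega))).add ((hm (by omega)).sub (hm (by omega)))
  norm_le i := by
    set s := i * (h + h)
    filter_upwards [hV.norm_condExp_sub_condExp_le s h (t := s + (h + h)) (by omega),
      hV.norm_condExp_le (s + h) h, hV.norm_condExp_le_of_le (s + h) h (Nat.le_add_right s h)]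
      with ω h1 h2 h3
    calc _ ≤ p h + (q h + q h) :=
          (norm_add_le _ _).trans (add_le_add h1 ((norm_sub_le _ _).trans (add_le_add h2 h3)))
      _ = _ := by ring
  condExp_eq_zero i := by
    change P[_ | 𝒢 (i * (h + h))] =ᵐ[P] 0
    set s := i * (h + h)
    have hi : ∀ {f : Ω → H} {t : ℕ}, Integrable (P[f | 𝒢 t]) P := integrable_condExp
    have ht : ∀ {f : Ω → H} {t : ℕ}, s ≤ t → P[P[f | 𝒢 t] | 𝒢 s] =ᵐ[P] P[f | 𝒢 s] :=
      fun ht => condExp_condExp_of_le (𝒢.mono ht) (𝒢.le _)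
    filter_upwards [condExp_add (hi.sub hi) (hi.sub hi) (𝒢 s)
        (f := P[V s h | 𝒢 (s + (h + h))] - P[V s h | 𝒢 (s + h)])
        (g := P[V (s + h) h | 𝒢 (s + h)] - P[V (s + h) h | 𝒢 s]),
      condExp_sub hi hi (𝒢 s) (f := P[V s h | 𝒢 (s + (h + h))]) (g := P[V s h | 𝒢 (s + h)]),
      condExp_sub hi hi (𝒢 s) (f := P[V (s + h) h | 𝒢 (s + h)]) (g := P[V (s + h) h | 𝒢 s]),
      ht (f := V s h) (t := s + (h + h)) (by omega), ht (f := V s h) (t := s + h) (by omega),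
      ht (f := V (s + h) h) (t := s + h) (by omega), ht (f := V (s + h) h) (t := s) le_rfl]
      with ω h1 h2 h3 h4 h5 h6 h7
    rw [blockDiff, h1, Pi.add_apply, h2, h3, Pi.sub_apply, Pi.sub_apply, h4, h5, h6, h7]
    simp

/-- Iterating `maxNorm_blockRem_le` while the number of blocks halves. The scale `2 ^ r h` carries a
martingale of about `N / 2 ^ r` steps bounded by twice the remainder, whence the weight
`√N / √2 ^ r`. -/
theorem gaussNormLE_maxNorm_blockRem (hV : IsBlockProcess P 𝒢 V p q) (L : ℕ) :
    ∀ h N : ℕ, 2 ^ L ≤ N → N < 2 ^ (L + 1) →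
      GaussNormLE P (maxNorm (fun i => blockRem P 𝒢 V h (i * h)) N)
        (4 * √N * ∑ r ∈ Finset.range (L + 1),
          (√2 ^ r)⁻¹ * (p (2 ^ r * h) + q (2 ^ r * h))) := by
  have hc : ∀ h, 0 ≤ p h + q h := fun h => add_nonneg (hV.nonneg_left h) (hV.nonneg_right h)
  induction L with
  | zero =>
    intro h N h1 h2
    obtain rfl : N = 1 := by simp at h1 h2; omega
    refine (gaussNormLE_of_bounded (c := p h + q h) ?_).mono (ae_of_all _ fun ω => le_rfl) ?_
    · filter_upwards [hV.norm_blockRem_le h 0] with ω hω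
      rw [abs_of_nonneg (maxNorm_nonneg _ _ _)]
      refine Finset.sup'_le _ _ fun k hk => ?_
      have : k = 0 ∨ k = 1 := by have := Finset.mem_range.1 hk; omega
      rcases this with rfl | rfl
      · simpa using hc h
      · simpa using hω
    · have := hc h
      simp
      linarith
  | succ L ih =>
    intro h N h1 h2
    have ihN := ih (h + h) (N / 2) (by rw [pow_succ] at h1; omega) (by rw [pow_succ] at h2; omega)
    have hD := (hV.isBoundedMartingaleDifference_blockDiff h).gaussNormLE_maxNorm (N / 2)
      (by have := hV.nonneg_left h; have := hV.nonneg_right h; positivity)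
    have hsum0 : 0 ≤ ∑ r ∈ Finset.range (L + 1),
        (√2 ^ r)⁻¹ * (p (2 ^ r * (h + h)) + q (2 ^ r * (h + h))) :=
      Finset.sum_nonneg fun r _ => mul_nonneg (by positivity) (hc _)
    have hp := hV.nonneg_left h
    have hq := hV.nonneg_right h
    have hDm := aemeasurable_maxNorm (P := P) (fun i =>
      (((hV.isBoundedMartingaleDifference_blockDiff h).stronglyMeasurable i).mono
        ((subFiltration 𝒢 (h + h)).le _)).aestronglyMeasurable) (N / 2)
    have hRm := aemeasurable_maxNorm (P := P)
      (fun i => hV.aestronglyMeasurable_blockRem (h + h) (i * (h + h))) (N / 2)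
    have htot := (hD.add ihN hDm (by positivity) (by positivity)).add
      (gaussNormLE_of_bounded (P := P) (Y := fun _ => p h + q h) (c := p h + q h)
        (ae_of_all _ fun _ => (abs_of_nonneg (hc h)).le)) (hDm.add hRm)
        (by positivity) (hc h)
    refine htot.mono ?_ ?_
    · filter_upwards [hV.maxNorm_blockRem_le h N] with ω hω
      rw [abs_of_nonneg (maxNorm_nonneg _ _ _)]
      exact hω.trans (le_abs_self _)
    · have hs2 : 0 < √(2 : ℝ) := by positivity
      have hs2' : √(2 : ℝ) * √2 = 2 := Real.mul_self_sqrt (by norm_num)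
      have hs2le : √(2 : ℝ) ≤ 3 / 2 := Real.sqrt_le_iff.2 ⟨by norm_num, by norm_num⟩
      have hN2 : √((N / 2 : ℕ) : ℝ) ≤ √N / √2 := by
        rw [← Real.sqrt_div (Nat.cast_nonneg N)]
        exact Real.sqrt_le_sqrt Nat.cast_div_le
      have hN1 : 1 ≤ √(N : ℝ) := by
        rw [Real.one_le_sqrt]
        exact_mod_cast (Nat.one_le_two_pow).trans h1
      rw [Finset.sum_range_succ' _ (L + 1)]
      have e : ∀ r ∈ Finset.range (L + 1),
          (√2 ^ (r + 1))⁻¹ * (p (2 ^ (r + 1) * h) + q (2 ^ (r + 1) * h)) =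
          (√2)⁻¹ * ((√2 ^ r)⁻¹ * (p (2 ^ r * (h + h)) + q (2 ^ r * (h + h)))) := by
        intro r _
        rw [show 2 ^ (r + 1) * h = 2 ^ r * (h + h) by ring, pow_succ, mul_inv]
        ring
      rw [Finset.sum_congr rfl e, ← Finset.mul_sum]
      set Q := ∑ r ∈ Finset.range (L + 1),
        (√2 ^ r)⁻¹ * (p (2 ^ r * (h + h)) + q (2 ^ r * (h + h)))
      have a1 : 4 * √((N / 2 : ℕ) : ℝ) * Q ≤ 4 * √N * ((√2)⁻¹ * Q) := by
        calc 4 * √((N / 2 : ℕ) : ℝ) * Q ≤ 4 * (√N / √2) * Q := by gcongr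
          _ = _ := by rw [div_eq_mul_inv]; ring
      have a2 : 2 * √((N / 2 : ℕ) : ℝ) * (p h + 2 * q h) ≤ 3 * √N * (p h + q h) := by
        calc 2 * √((N / 2 : ℕ) : ℝ) * (p h + 2 * q h)
            ≤ 2 * (√N / √2) * (2 * (p h + q h)) := by gcongr; linarith
          _ = (2 * √2) * √N * (p h + q h) := by
              rw [show 2 * (√N / √2) * (2 * (p h + q h)) = 4 / √2 * √N * (p h + q h) by ring,
                show 4 / √(2 : ℝ) = 2 * √2 by rw [div_eq_iff hs2.ne', mul_assoc, hs2']; norm_num]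
          _ ≤ _ := by gcongr; linarith
      have a3 : p h + q h ≤ √N * (p h + q h) := le_mul_of_one_le_left (hc h) hN1
      simp only [pow_zero, inv_one, one_mul, mul_add] at *
      linarith

/-- The sharp constant in front of `A`: the finest martingale has the differences
`P[V i 1 | 𝒢 (i + 1)] - P[V i 1 | 𝒢 i]`, bounded by `A + q 1`. -/
theorem gaussNormLE_maxNorm (hV : IsBlockProcess P 𝒢 V p q) {A : ℝ}
    (hA : ∀ s, ∀ᵐ ω ∂P, ‖V s 1 ω‖ ≤ A) (hA0 : 0 ≤ A) {L n : ℕ} (hL : 2 ^ L ≤ n)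
    (hL' : n < 2 ^ (L + 1)) :
    GaussNormLE P (maxNorm (fun i => V i 1) n)
      (2 * √n * (A + q 1) +
        4 * √n * ∑ r ∈ Finset.range (L + 1), (√2 ^ r)⁻¹ * (p (2 ^ r) + q (2 ^ r))) := by
  have hmd : IsBoundedMartingaleDifference P 𝒢
      (fun i => P[V i 1 | 𝒢 (i + 1)] - P[V i 1 | 𝒢 i]) (A + q 1) :=
    { stronglyMeasurable := fun i => stronglyMeasurable_condExp.sub
        (stronglyMeasurable_condExp.mono (𝒢.mono i.le_succ))
      norm_le := fun i => by
        filter_upwards [ae_bdd_norm_condExp_of_ae_bdd_norm (m := 𝒢 (i + 1)) (hA i),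
          hV.norm_condExp_le i 1] with ω h1 h2
        exact (norm_sub_le _ _).trans (add_le_add h1 h2)
      condExp_eq_zero := fun i => by
        filter_upwards [condExp_sub (integrable_condExp (m := 𝒢 (i + 1)) (f := V i 1) (μ := P))
            (integrable_condExp (m := 𝒢 i) (f := V i 1) (μ := P)) (𝒢 i),
          condExp_condExp_of_le (f := V i 1) (μ := P) (𝒢.mono i.le_succ) (𝒢.le _),
          condExp_condExp_of_le (f := V i 1) (μ := P) (le_refl (𝒢 i)) (𝒢.le _)] with ω h1 h2 h3
        rw [h1, Pi.sub_apply, h2, h3]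
        simp }
  have hD := hmd.gaussNormLE_maxNorm n (add_nonneg hA0 (hV.nonneg_right 1))
  have hR := hV.gaussNormLE_maxNorm_blockRem L 1 n hL hL'
  simp only [mul_one] at hR
  have hDm := aemeasurable_maxNorm (P := P) (fun i =>
      ((hmd.stronglyMeasurable i).mono (𝒢.le _)).aestronglyMeasurable) n
  refine (hD.add hR hDm ?_ ?_).mono (ae_of_all _ fun ω => ?_) le_rfl
  · have := hV.nonneg_right 1
    positivity
  · exact mul_nonneg (by positivity) (Finset.sum_nonneg fun r _ => mul_nonneg (by positivity)
      (add_nonneg (hV.nonneg_left _) (hV.nonneg_right _)))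
  rw [abs_of_nonneg (maxNorm_nonneg _ _ _)]
  refine le_trans (Finset.sup'_le _ _ fun k hk => ?_) (le_abs_self _)
  have hk' : k ≤ n := Nat.lt_succ_iff.1 (Finset.mem_range.1 hk)
  have e : ∑ i ∈ Finset.range k, V i 1 ω =
      ∑ i ∈ Finset.range k, (P[V i 1 | 𝒢 (i + 1)] - P[V i 1 | 𝒢 i]) ω +
        ∑ i ∈ Finset.range k, blockRem P 𝒢 V 1 i ω := by
    rw [← Finset.sum_add_distrib]
    refine Finset.sum_congr rfl fun i _ => ?_
    simp only [blockRem, Pi.add_apply, Pi.sub_apply]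
    abel
  rw [e]
  exact (norm_add_le _ _).trans (add_le_add (le_maxNorm _ hk' ω)
    (le_maxNorm (fun i => blockRem P 𝒢 V 1 i) hk' ω))

end IsBlockProcess

end Dyadic

/-! ### Dyadic sums of a weakly subadditive sequence -/

section DyadicSums

variable {c : ℕ → ℝ}

/-- Averaging `c m ≤ 2 (c j + c (m - j))` over `0 < j < m = 2 ^ (r + 1)`, with `m ≤ 2 (m - 1)`. -/
lemma pow_two_mul_le_sum (hc0 : ∀ j, 0 ≤ c j)
    (hc : ∀ i j, c (i + j) ≤ 2 * (c i + c j)) (r : ℕ) :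
    2 ^ (r + 1) * c (2 ^ (r + 1)) ≤ 8 * ∑ j ∈ Finset.Ico 1 (2 ^ (r + 1)), c j := by
  set m := 2 ^ (r + 1) with hm
  have hm2 : 2 ≤ m := by rw [hm, pow_succ]; have := Nat.one_le_two_pow (n := r); omega
  have h1 : ∑ j ∈ Finset.Ico 1 m, c m ≤ ∑ j ∈ Finset.Ico 1 m, 2 * (c j + c (m - j)) := by
    refine Finset.sum_le_sum fun j hj => ?_
    have hj' := Finset.mem_Ico.1 hj
    have := hc j (m - j)
    rwa [Nat.add_sub_cancel' hj'.2.le] at this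
  have h2 : ∑ j ∈ Finset.Ico 1 m, c (m - j) = ∑ j ∈ Finset.Ico 1 m, c j := by
    have := Finset.sum_Ico_reflect c 1 (n := m) (m := m) (by omega)
    simpa using this
  rw [← Finset.mul_sum, Finset.sum_add_distrib, h2, Finset.sum_const, Nat.card_Ico, nsmul_eq_mul,
    Nat.cast_sub (by omega)] at h1
  have h3 : (2 : ℝ) ≤ m := by exact_mod_cast hm2
  have h4 := hc0 m
  have h5 : (2 : ℝ) ^ (r + 1) = m := by rw [hm]; norm_num
  rw [h5]
  push_cast at h1
  nlinarith

/-- Bounding each `c (2 ^ r)` by the average of the earlier terms turns the dyadic series into the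
series with weights `j ^ (-3/2)`. -/
lemma sum_dyadic_le (hc0 : ∀ j, 0 ≤ c j)
    (hc : ∀ i j, c (i + j) ≤ 2 * (c i + c j)) {L n : ℕ} (hL : 2 ^ L ≤ n) :
    ∑ r ∈ Finset.range (L + 1), (√2 ^ r)⁻¹ * c (2 ^ r) ≤
      17 * ∑ j ∈ Finset.Icc 1 n, 1 / (j : ℝ) ^ (3 / 2 : ℝ) * c j := by
  set S : ℕ → ℝ := fun m => ∑ j ∈ Finset.Ico 1 m, c j with hS
  set t : ℝ := (√2 * 2)⁻¹ with ht
  have hs2 : 1 ≤ √(2 : ℝ) := by rw [Real.one_le_sqrt]; norm_num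
  have ht0 : 0 < t := by positivity
  have ht1 : t ≤ 1 / 2 := by
    rw [ht, one_div]; exact inv_anti₀ (by norm_num) (by linarith)
  have hS0 : ∀ m, 0 ≤ S m := fun m => Finset.sum_nonneg fun j _ => hc0 j
  have hterm : ∀ r, (√2 ^ (r + 1))⁻¹ * c (2 ^ (r + 1)) ≤ 8 * (t ^ (r + 1) * S (2 ^ (r + 1))) := by
    intro r
    have h1 := pow_two_mul_le_sum hc0 hc r
    have h2 : t ^ (r + 1) = (√2 ^ (r + 1))⁻¹ * ((2 : ℝ) ^ (r + 1))⁻¹ := by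
      rw [ht, inv_pow, mul_pow, mul_inv]
    have h3 : c (2 ^ (r + 1)) ≤ ((2 : ℝ) ^ (r + 1))⁻¹ * (8 * S (2 ^ (r + 1))) := by
      rw [← div_eq_inv_mul, le_div_iff₀ (by positivity), mul_comm]
      exact h1
    calc (√2 ^ (r + 1))⁻¹ * c (2 ^ (r + 1))
        ≤ (√2 ^ (r + 1))⁻¹ * (((2 : ℝ) ^ (r + 1))⁻¹ * (8 * S (2 ^ (r + 1)))) := by gcongr
      _ = _ := by rw [h2]; ring
  have hweight : ∀ m j : ℕ, 1 ≤ j → j ≤ 2 ^ m → t ^ m ≤ 1 / (j : ℝ) ^ (3 / 2 : ℝ) := by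
    intro m j hj1 hj
    have hj0 : (0 : ℝ) < j := by exact_mod_cast hj1
    rw [ht, inv_pow, ← one_div]
    refine one_div_le_one_div_of_le (by positivity) ?_
    have hj' : (j : ℝ) ≤ 2 ^ m := by exact_mod_cast hj
    calc (j : ℝ) ^ (3 / 2 : ℝ) = √j * j := by
          rw [Real.sqrt_eq_rpow, show (3 / 2 : ℝ) = 1 / 2 + 1 by norm_num,
            Real.rpow_add hj0, Real.rpow_one]
      _ ≤ √(2 ^ m) * 2 ^ m := by gcongr
      _ = (√2 * 2) ^ m := by
          rw [mul_pow]
          congr 1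
          rw [Real.sqrt_eq_iff_mul_self_eq (by positivity) (by positivity), ← mul_pow,
            Real.mul_self_sqrt (by norm_num)]
  -- Summation by parts: the second term is the tail `∑ r > m` of the geometric series with
  -- `S (2 ^ r)` frozen at `S (2 ^ m)`.
  have hpot : ∀ m : ℕ, ∑ r ∈ Finset.range (m + 1), t ^ r * S (2 ^ r) +
      t ^ (m + 1) * S (2 ^ m) / (1 - t) ≤
      (∑ j ∈ Finset.Ico (1 : ℕ) (2 ^ m), 1 / (j : ℝ) ^ (3 / 2 : ℝ) * c j) / (1 - t) := by
    have h1t : 0 < 1 - t := by linarith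
    intro m
    induction m with
    | zero => simp [hS]
    | succ m ih =>
      have hsplit : ∀ f : ℕ → ℝ, ∑ j ∈ Finset.Ico 1 (2 ^ (m + 1)), f j =
          ∑ j ∈ Finset.Ico 1 (2 ^ m), f j + ∑ j ∈ Finset.Ico (2 ^ m) (2 ^ (m + 1)), f j := fun f =>
        (Finset.sum_Ico_consecutive f Nat.one_le_two_pow
          (Nat.pow_le_pow_right (by norm_num) m.le_succ)).symm
      have hB : t ^ (m + 1) * ∑ j ∈ Finset.Ico (2 ^ m) (2 ^ (m + 1)), c j ≤
          ∑ j ∈ Finset.Ico (2 ^ m : ℕ) (2 ^ (m + 1)), 1 / (j : ℝ) ^ (3 / 2 : ℝ) * c j := by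
        rw [Finset.mul_sum]
        refine Finset.sum_le_sum fun j hj => ?_
        have hj' := Finset.mem_Ico.1 hj
        exact mul_le_mul_of_nonneg_right
          (hweight _ _ (Nat.one_le_two_pow.trans hj'.1) hj'.2.le) (hc0 j)
      rw [Finset.sum_range_succ, hsplit (fun j => 1 / (j : ℝ) ^ (3 / 2 : ℝ) * c j), add_div]
      have hSs : S (2 ^ (m + 1)) = S (2 ^ m) + ∑ j ∈ Finset.Ico (2 ^ m) (2 ^ (m + 1)), c j :=
        hsplit c
      have hB' := div_le_div_of_nonneg_right hB h1t.le
      have e : t ^ (m + 1) * S (2 ^ (m + 1)) + t ^ (m + 1 + 1) * S (2 ^ (m + 1)) / (1 - t) =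
          t ^ (m + 1) * S (2 ^ m) / (1 - t) +
          t ^ (m + 1) * (∑ j ∈ Finset.Ico (2 ^ m) (2 ^ (m + 1)), c j) / (1 - t) := by
        rw [hSs]
        field_simp
        ring
      linarith
  have hsub : ∑ j ∈ Finset.Ico (1 : ℕ) (2 ^ L), 1 / (j : ℝ) ^ (3 / 2 : ℝ) * c j ≤
      ∑ j ∈ Finset.Icc 1 n, 1 / (j : ℝ) ^ (3 / 2 : ℝ) * c j := by
    refine Finset.sum_le_sum_of_subset_of_nonneg ?_ fun j _ _ => mul_nonneg (by positivity) (hc0 j)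
    intro j hj
    have := Finset.mem_Ico.1 hj
    exact Finset.mem_Icc.2 ⟨this.1, by omega⟩
  have hone : c 1 ≤ ∑ j ∈ Finset.Icc 1 n, 1 / (j : ℝ) ^ (3 / 2 : ℝ) * c j := by
    have := Finset.single_le_sum (f := fun j : ℕ => 1 / (j : ℝ) ^ (3 / 2 : ℝ) * c j)
      (fun j _ => mul_nonneg (by positivity) (hc0 j))
      (Finset.mem_Icc.2 ⟨le_rfl, Nat.one_le_two_pow.trans hL⟩ : 1 ∈ Finset.Icc 1 n)
    simpa using this
  set Δ := ∑ j ∈ Finset.Icc 1 n, 1 / (j : ℝ) ^ (3 / 2 : ℝ) * c j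
  have hΔ0 : 0 ≤ Δ := (hc0 1).trans hone
  have hsum : ∑ r ∈ Finset.range (L + 1), t ^ r * S (2 ^ r) ≤ 2 * Δ := by
    have h1 := hpot L
    have h2 : 0 ≤ t ^ (L + 1) * S (2 ^ L) / (1 - t) :=
      div_nonneg (mul_nonneg (by positivity) (hS0 _)) (by linarith)
    have h3 : Δ / (1 - t) ≤ 2 * Δ := by
      rw [div_le_iff₀ (by linarith)]
      nlinarith
    have h4 := div_le_div_of_nonneg_right hsub (by linarith : (0 : ℝ) ≤ 1 - t)
    linarith
  rw [Finset.sum_range_succ'] at hsum ⊢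
  have h0 : S (2 ^ 0) = 0 := by simp [hS]
  have := Finset.sum_le_sum fun r (_ : r ∈ Finset.range L) => hterm r
  rw [← Finset.mul_sum] at this
  rw [h0] at hsum
  simp only [pow_zero, inv_one, one_mul]
  linarith

end DyadicSums

/-! ### Partial sums of a stationary sequence -/

section Stationary

/-- Conditional expectation is equivariant under measure-preserving maps. -/
lemma condExp_comp_of_measurePreserving {Ω : Type*} {m mΩ : MeasurableSpace Ω} {P : Measure Ω}
    [IsFiniteMeasure P] {E : Type*} [NormedAddCommGroup E] [NormedSpace ℝ E] [CompleteSpace E]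
    {τ : Ω → Ω} (hτ : MeasurePreserving τ P P) (hτe : MeasurableEmbedding τ) (hm : m ≤ mΩ)
    {f : Ω → E} (hf : Integrable f P) :
    P[f ∘ τ | m.comap τ] =ᵐ[P] P[f | m] ∘ τ := by
  have hm' : m.comap τ ≤ mΩ := by
    rintro _ ⟨s, hs, rfl⟩
    exact hτ.measurable (hm s hs)
  have hg : Integrable (P[f | m] ∘ τ) P := hτ.integrable_comp_of_integrable integrable_condExp
  refine (ae_eq_condExp_of_forall_setIntegral_eq hm' (hτ.integrable_comp_of_integrable hf)
    (fun _ _ _ => hg.integrableOn) ?_ ?_).symm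
  · rintro _ ⟨s, hs, rfl⟩ -
    exact ((hτ.setIntegral_preimage_emb hτe _ s).trans (setIntegral_condExp hm hf hs)).trans
      (hτ.setIntegral_preimage_emb hτe f s).symm
  · exact (stronglyMeasurable_condExp.comp_measurable
      (comap_measurable τ)).aestronglyMeasurable

variable {Ω : Type u} {F₀ : MeasurableSpace Ω} [mΩ : MeasurableSpace Ω] {T : Ω ≃ᵐ Ω}

lemma zpow_natCast_coe (i : ℕ) : ⇑(T.toEquiv ^ (i : ℤ) : Equiv.Perm Ω) = T^[i] := by
  rw [zpow_natCast]
  exact (Equiv.Perm.iterate_eq_pow T.toEquiv i).symm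

lemma filt_natCast (i : ℕ) : filt T.toEquiv F₀ (i : ℤ) = F₀.comap T^[i] := by
  rw [filt, zpow_natCast_coe]

lemma measurableEmbedding_iterate (i : ℕ) : MeasurableEmbedding T^[i] := by
  induction i with
  | zero => exact MeasurableEmbedding.id
  | succ i ih => exact ih.comp T.measurableEmbedding

/-- The `σ`-fields `T⁻ⁱ(F₀)` for `i ≥ 0`, as a filtration. -/
def natFiltration (T : Ω ≃ᵐ Ω) (hF : F₀ ≤ mΩ) (hT : F₀ ≤ F₀.comap T) :
    Filtration ℕ mΩ where
  seq i := filt T.toEquiv F₀ (i : ℤ)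
  mono' := monotone_nat_of_le_succ fun i => by
    rw [filt_natCast, filt_natCast, Function.iterate_succ', ← MeasurableSpace.comap_comp]
    exact MeasurableSpace.comap_mono hT
  le' i := by
    rw [filt_natCast]
    rintro _ ⟨s, hs, rfl⟩
    exact (measurableEmbedding_iterate i).measurable (hF s hs)

variable {H : Type v} [NormedAddCommGroup H]

lemma partialSum_eq (X₀ : Ω → H) (n : ℕ) (ω : Ω) :
    partialSum T.toEquiv X₀ n ω = ∑ j ∈ Finset.range n, X₀ (T^[j + 1] ω) := by
  induction n with
  | zero => simp [partialSum]
  | succ n ih =>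
    rw [Finset.sum_range_succ, ← ih, partialSum, Finset.sum_Icc_succ_top (by omega), partialSum,
      seq, zpow_natCast_coe]

lemma partialSum_add (X₀ : Ω → H) (h h' : ℕ) (ω : Ω) :
    partialSum T.toEquiv X₀ (h + h') ω =
      partialSum T.toEquiv X₀ h ω + partialSum T.toEquiv X₀ h' (T^[h] ω) := by
  rw [partialSum_eq, partialSum_eq, partialSum_eq, Finset.sum_range_add]
  congr 1
  refine Finset.sum_congr rfl fun j _ => ?_
  rw [← Function.iterate_add_apply]
  congr 2
  ring

lemma norm_le_linfNorm {P : Measure Ω} {Y : Ω → H} (hY : MemLp Y ∞ P) :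
    ∀ᵐ ω ∂P, ‖Y ω‖ ≤ linfNorm P Y := by
  filter_upwards [enorm_ae_le_eLpNormEssSup Y P] with ω hω
  rw [linfNorm, ← toReal_enorm]
  refine ENNReal.toReal_mono hY.eLpNorm_ne_top ?_
  rwa [eLpNorm_exponent_top]

lemma linfNorm_nonneg {P : Measure Ω} (Y : Ω → H) : 0 ≤ linfNorm P Y := ENNReal.toReal_nonneg

lemma linfNorm_le_of_ae_bound {P : Measure Ω} {Y : Ω → H} {c : ℝ} (hc : 0 ≤ c)
    (h : ∀ᵐ ω ∂P, ‖Y ω‖ ≤ c) : linfNorm P Y ≤ c := by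
  refine ENNReal.toReal_le_of_le_ofReal hc ?_
  rw [eLpNorm_exponent_top]
  exact eLpNormEssSup_le_of_ae_bound h

variable {P : Measure Ω} {X₀ : Ω → H}

lemma memLp_partialSum (hT : MeasurePreserving T P P) (hX : MemLp X₀ ∞ P) (n : ℕ) :
    MemLp (partialSum T.toEquiv X₀ n) ∞ P := by
  have : partialSum T.toEquiv X₀ n = fun ω => ∑ j ∈ Finset.range n, (X₀ ∘ T^[j + 1]) ω := by
    ext ω; exact partialSum_eq X₀ n ω
  rw [this]
  exact memLp_finsetSum _ fun j _ => hX.comp_measurePreserving (hT.iterate _)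

lemma isBlockProcess_partialSum [InnerProductSpace ℝ H] [CompleteSpace H] [IsProbabilityMeasure P]
    (hT : MeasurePreserving T P P) (hF : F₀ ≤ mΩ)
    (hFT : F₀ ≤ F₀.comap T) (hX : MemLp X₀ ∞ P) :
    IsBlockProcess P (natFiltration T hF hFT)
      (fun s h ω => partialSum T.toEquiv X₀ h (T^[s] ω))
      (fun h => linfNorm P (partialSum T.toEquiv X₀ h -
        P[partialSum T.toEquiv X₀ h | filt T.toEquiv F₀ (h : ℤ)]))
      (fun h => linfNorm P (P[partialSum T.toEquiv X₀ h | F₀])) := by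
  have hS := memLp_partialSum hT hX
  have hSi : ∀ n, Integrable (partialSum T.toEquiv X₀ n) P := fun n => (hS n).integrable (by simp)
  have hTi := fun s : ℕ => hT.iterate s
  have hle : ∀ h : ℕ, filt T.toEquiv F₀ (h : ℤ) ≤ mΩ := (natFiltration T hF hFT).le
  refine ⟨fun s h => (hTi s).integrable_comp_of_integrable (hSi h), fun s h h' => ?_,
    fun s h => ?_, fun s h => ?_, fun h => linfNorm_nonneg _, fun h => linfNorm_nonneg _⟩
  · ext ω
    rw [Pi.add_apply, partialSum_add, add_comm s h, Function.iterate_add_apply]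
  · have e : natFiltration T hF hFT (s + h) = (filt T.toEquiv F₀ (h : ℤ)).comap T^[s] := by
      change filt T.toEquiv F₀ ((s + h : ℕ) : ℤ) = _
      rw [filt_natCast, filt_natCast, MeasurableSpace.comap_comp, ← Function.iterate_add, add_comm]
    rw [e]
    filter_upwards [condExp_comp_of_measurePreserving (hTi s) (measurableEmbedding_iterate s)
        (hle h) (hSi h),
      (hTi s).quasiMeasurePreserving.ae (norm_le_linfNorm ((hS h).sub ((hS h).condExp
        (m := filt T.toEquiv F₀ (h : ℤ)) (by simp))))] with ω h1 h2
    change ‖_ - P[partialSum T.toEquiv X₀ h ∘ T^[s] | _] ω‖ ≤ _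
    rw [h1]
    exact h2
  · have e : natFiltration T hF hFT s = F₀.comap T^[s] := filt_natCast s
    rw [e]
    filter_upwards [condExp_comp_of_measurePreserving (hTi s) (measurableEmbedding_iterate s)
        hF (hSi h),
      (hTi s).quasiMeasurePreserving.ae (norm_le_linfNorm ((hS h).condExp
        (m := F₀) (by simp)))] with ω h1 h2
    change ‖P[partialSum T.toEquiv X₀ h ∘ T^[s] | _] ω‖ ≤ _
    rw [h1]
    exact h2

lemma maxEvent_subset (T : Ω ≃ᵐ Ω) (X₀ : Ω → H) {n : ℕ} (hn : 1 ≤ n) (x : ℝ) :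
    maxEvent T.toEquiv X₀ n hn x ⊆ {ω | x ≤ maxNorm (fun i ω => X₀ (T^[i + 1] ω)) n ω} := by
  intro ω hω
  rw [maxEvent, Set.mem_ofPred_eq] at hω
  refine le_trans hω (Finset.sup'_le _ _ fun k hk => ?_)
  rw [partialSum_eq]
  exact le_maxNorm (fun i ω => X₀ (T^[i + 1] ω)) (Finset.mem_Icc.1 hk).2 ω

theorem gaussNormLE_maxNorm_seq [InnerProductSpace ℝ H] [CompleteSpace H] [IsProbabilityMeasure P]
    (hT : MeasurePreserving T P P) (hF : F₀ ≤ mΩ)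
    (hFT : F₀ ≤ F₀.comap T) (hX : MemLp X₀ ∞ P) {n : ℕ} (hn : 1 ≤ n) :
    GaussNormLE P (maxNorm (fun i ω => X₀ (T^[i + 1] ω)) n)
      (2 * √n * (linfNorm P X₀ + 35 * delta F₀ P T.toEquiv X₀ n)) := by
  have hV := isBlockProcess_partialSum hT hF hFT hX
  have h1 : (fun i ω => partialSum T.toEquiv X₀ 1 (T^[i] ω)) = fun i ω => X₀ (T^[i + 1] ω) := by
    ext i ω
    rw [partialSum_eq, Finset.sum_range_one, ← Function.iterate_add_apply, zero_add, add_comm]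
  have hA : ∀ s, ∀ᵐ ω ∂P, ‖partialSum T.toEquiv X₀ 1 (T^[s] ω)‖ ≤ linfNorm P X₀ := by
    intro s
    filter_upwards [(hT.iterate (s + 1)).quasiMeasurePreserving.ae (norm_le_linfNorm hX)] with ω hω
    rwa [congrFun (congrFun h1 s) ω]
  have key := hV.gaussNormLE_maxNorm hA (linfNorm_nonneg _) (L := Nat.log 2 n) (n := n)
    (Nat.pow_log_le_self 2 (by omega)) (Nat.lt_pow_succ_log_self (by norm_num) n)
  rw [h1] at key
  refine key.mono (ae_of_all _ fun _ => le_rfl) ?_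
  set p : ℕ → ℝ := fun h => linfNorm P (partialSum T.toEquiv X₀ h -
    P[partialSum T.toEquiv X₀ h | filt T.toEquiv F₀ (h : ℤ)]) with hp
  set q : ℕ → ℝ := fun h => linfNorm P (P[partialSum T.toEquiv X₀ h | F₀]) with hq
  have hp0 : ∀ h, 0 ≤ p h := fun h => linfNorm_nonneg _
  have hq0 : ∀ h, 0 ≤ q h := fun h => linfNorm_nonneg _
  have hpadd : ∀ i j, p (i + j) ≤ 2 * p i + p j := by
    intro i j
    refine linfNorm_le_of_ae_bound (by have := hp0 i; have := hp0 j; positivity) ?_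
    have := hV.norm_sub_condExp_add_le 0 i j
    rw [zero_add] at this
    exact this
  have hqadd : ∀ i j, q (i + j) ≤ q i + q j := by
    intro i j
    refine linfNorm_le_of_ae_bound (by have := hq0 i; have := hq0 j; positivity) ?_
    have h0 : natFiltration T hF hFT 0 = F₀ := by
      refine (filt_natCast 0).trans ?_
      rw [Function.iterate_zero, MeasurableSpace.comap_id]
    have := hV.norm_condExp_add_le 0 i j
    rw [h0] at this
    exact this
  have hdy := sum_dyadic_le (c := fun j => p j + q j) (fun j => add_nonneg (hp0 j) (hq0 j))
    (fun i j => by linarith [hpadd i j, hqadd i j, hp0 j, hq0 i, hq0 j])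
    (Nat.pow_log_le_self 2 (by omega : n ≠ 0))
  have hΔ : ∑ j ∈ Finset.Icc 1 n, 1 / (j : ℝ) ^ (3 / 2 : ℝ) * (p j + q j) =
      delta F₀ P T.toEquiv X₀ n := by
    rw [delta]
    exact Finset.sum_congr rfl fun j _ => by rw [add_comm (p j)]
  rw [hΔ] at hdy
  have hq1 : q 1 ≤ delta F₀ P T.toEquiv X₀ n := by
    rw [← hΔ]
    have := Finset.single_le_sum (f := fun j : ℕ => 1 / (j : ℝ) ^ (3 / 2 : ℝ) * (p j + q j))
      (fun j _ => mul_nonneg (by positivity) (add_nonneg (hp0 j) (hq0 j)))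
      (Finset.mem_Icc.2 ⟨le_rfl, hn⟩ : 1 ∈ Finset.Icc 1 n)
    simp only [Nat.cast_one, Real.one_rpow, div_one, one_mul] at this
    linarith [hp0 1]
  have hsn : 0 ≤ √(n : ℝ) := Real.sqrt_nonneg _
  calc _ = 2 * √n * (linfNorm P X₀ + q 1 + 2 * ∑ r ∈ Finset.range (Nat.log 2 n + 1),
        (√2 ^ r)⁻¹ * (p (2 ^ r) + q (2 ^ r))) := by ring
    _ ≤ _ := by
        refine mul_le_mul_of_nonneg_left ?_ (by positivity)
        linarith

end Stationary

end HilbertHoeffding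

theorem mainTheorem2 :
    ∃ C : ℝ, 0 < C ∧
      ∀ (H : Type v) [NormedAddCommGroup H] [InnerProductSpace ℝ H] [CompleteSpace H]
        [TopologicalSpace.SeparableSpace H] [MeasurableSpace H] [BorelSpace H]
        (Ω : Type u) (F₀ : MeasurableSpace Ω) [mΩ : MeasurableSpace Ω]
        (P : Measure Ω) [IsProbabilityMeasure P]
        (T : Ω ≃ᵐ Ω) (X₀ : Ω → H),
        MeasurePreserving T P P →
        F₀ ≤ mΩ →
        F₀ ≤ F₀.comap T →
        Measurable X₀ →
        eLpNorm X₀ ∞ P < ∞ →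
        ∫ ω, X₀ ω ∂P = 0 →
        ∀ (n : ℕ) (hn : 1 ≤ n) (x : ℝ), 0 < x →
          (0 < HilbertHoeffding.linfNorm P X₀ + C * HilbertHoeffding.delta F₀ P T.toEquiv X₀ n →
            P.real (HilbertHoeffding.maxEvent T.toEquiv X₀ n hn x) ≤
              2 * √(Real.exp 1) *
                Real.exp (-(x ^ 2 / (4 * n * (HilbertHoeffding.linfNorm P X₀ +
                  C * HilbertHoeffding.delta F₀ P T.toEquiv X₀ n) ^ 2)))) ∧
          (HilbertHoeffding.linfNorm P X₀ + C * HilbertHoeffding.delta F₀ P T.toEquiv X₀ n = 0 →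
            P (HilbertHoeffding.maxEvent T.toEquiv X₀ n hn x) = 0) := by
  refine ⟨35, by norm_num, ?_⟩
  intro H _ _ _ _ _ _ Ω F₀ mΩ P _ T X₀ hT hF hFT hXm hXb _ n hn x hx
  have hX : MemLp X₀ ∞ P := ⟨hXm.aestronglyMeasurable, hXb⟩
  set B := HilbertHoeffding.linfNorm P X₀ + 35 * HilbertHoeffding.delta F₀ P T.toEquiv X₀ n with hB
  have hG : HilbertHoeffding.GaussNormLE P _ (2 * √n * B) :=
    HilbertHoeffding.gaussNormLE_maxNorm_seq hT hF hFT hX hn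
  have hn0 : (0 : ℝ) < n := by exact_mod_cast hn
  have hsub := measure_mono (μ := P) (HilbertHoeffding.maxEvent_subset T X₀ hn x)
  have hmeas := HilbertHoeffding.aemeasurable_maxNorm (P := P)
    (fun i => (hX.comp_measurePreserving (hT.iterate (i + 1))).aestronglyMeasurable) n
  refine ⟨fun hBpos => ?_, fun hBzero => ?_⟩
  · have h1 : P.real (HilbertHoeffding.maxEvent T.toEquiv X₀ n hn x) ≤
        3 * Real.exp (-(x / (2 * √n * B)) ^ 2) :=
      ENNReal.toReal_le_of_le_ofReal (by positivity)
        (hsub.trans (hG.measure_le (by positivity) hx.le hmeas))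
    have h2 : (x / (2 * √n * B)) ^ 2 = x ^ 2 / (4 * n * B ^ 2) := by
      rw [div_pow, mul_pow, mul_pow, Real.sq_sqrt hn0.le]
      norm_num
    have h3 : 3 / 2 ≤ √(Real.exp 1) := by
      apply Real.le_sqrt_of_sq_le
      linarith [Real.exp_one_gt_d9]
    rw [h2] at h1
    refine h1.trans ?_
    gcongr
    linarith
  · rw [hBzero, mul_zero] at hG
    exact le_antisymm (hsub.trans (hG.measure_eq_zero hx hmeas).le) zero_le
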